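/- Let $\nu>0$ and $a>0$, and let $J_\mu$ and $Y_\mu$ denote the Bessel functions of the first and of the second kind. For $z\in\mathbb C\setminus\{0\}$, $x>0$ and $\mu>0$ put $$\xi_\mu(z,x)=z^{-\mu/2}\sqrt{\tfrac{\pi x}{2}}\,J_\mu(\sqrt z\,x),$$ $$\theta_\mu(z,x)=z^{\mu/2}\sqrt{\tfrac{\pi x}{2}}\cdot\begin{cases}\dfrac{1}{\sin(\mu\pi)}\,J_{-\mu}(\sqrt z\,x), & \mu\notin\mathbb N,\\[2mm] \dfrac1\pi\log(z)\,J_\mu(\sqrt z\,x)-Y_\mu(\sqrt z\,x), & \mu\in\mathbb N,\end{cases}$$ with principal branches throughout. Let $q$ be a real-valued function on $(0,a)$ such that $\widetilde q(x):=x\,q(x)$ belongs to $L^r(0,a)$ for some $r\in(2,\infty]$, and put $$Q_1(z,x)=\int_0^x q(y)\,\theta_\nu(z,y)\,\xi_\nu(z,y)\,dy,\qquad Q_2(z,x)=\int_0^x q(y)\,\xi_\nu(z,y)^2\,dy .$$ Then the integrals defining $Q_1(t^2,a)$ and $Q_2(t^2,a)$ converge absolutely for all real $t\ge 1$, and there exist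 $C>0$ and $\delta>0$ (which may depend on $\nu$, $a$, $r$ and $q$, but not on $t$) such that $$\left|Q_1(t^2,a)\,\xi_{\nu+1}(t^2,a)-t^{-2}\,Q_2(t^2,a)\,\theta_{\nu+1}(t^2,a)\right|\le C\,t^{-\nu-\frac32-\delta}\qquad\text{for all real } t\ge 1 .$$ -/

import Mathlib

open MeasureTheory
open scoped ENNReal Nat

noncomputable section

namespace PerturbedBessel

/-- The Bessel function of the first kind `J_μ(w)`, of complex order `μ`, by its power series,
with the principal branch of the power `(w/2)^μ`. The factor `(Γ(μ+k+1))⁻¹` is the entire function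
`1/Γ`: Mathlib's `Complex.Gamma` is `0` at the poles, hence so is its inverse. -/
def besselJ (μ w : ℂ) : ℂ :=
  (w / 2) ^ μ * ∑' k : ℕ, (-(w ^ 2 / 4)) ^ k * ((k ! : ℂ) * Complex.Gamma (μ + k + 1))⁻¹

/-- The Neumann function (Bessel function of the second kind) `Y_n(w)` of integer order `n ≥ 0`,
with the principal branch of the logarithm; `Complex.digamma = Γ' / Γ`. -/
def besselYNat (n : ℕ) (w : ℂ) : ℂ :=
  (2 / (Real.pi : ℂ)) * Complex.log (w / 2) * besselJ n w
    - (1 / (Real.pi : ℂ)) * ((w / 2) ^ n)⁻¹ *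
        ∑ k ∈ Finset.range n, (((n - k - 1)! : ℕ) : ℂ) / (k ! : ℂ) * (w ^ 2 / 4) ^ k
    - (1 / (Real.pi : ℂ)) * (w / 2) ^ n *
        ∑' k : ℕ, (Complex.digamma (k + 1) + Complex.digamma (n + k + 1)) *
          (-(w ^ 2 / 4)) ^ k / ((k ! : ℂ) * ((n + k)! : ℂ))

/-- Principal branch of the complex square root. -/
def csqrt (z : ℂ) : ℂ := z ^ (1 / 2 : ℂ)

/-- `ξ_ν(z,x) = z^{-ν/2} √(πx/2) J_ν(√z x)`. -/
def xi (ν : ℝ) (z : ℂ) (x : ℝ) : ℂ :=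
  z ^ (-(ν : ℂ) / 2) * (Real.sqrt (Real.pi * x / 2) : ℂ) * besselJ (ν : ℂ) (csqrt z * x)

open Classical in
/-- `θ_ν(z,x) = z^{ν/2} √(πx/2) · J_{-ν}(√z x) / sin(νπ)` if `ν` is not a nonnegative integer, and
`θ_ν(z,x) = z^{ν/2} √(πx/2) · ((1/π) log(z) J_ν(√z x) - Y_ν(√z x))` if it is
(then `ν = ⌊ν⌋₊`). -/
def theta (ν : ℝ) (z : ℂ) (x : ℝ) : ℂ :=
  z ^ ((ν : ℂ) / 2) * (Real.sqrt (Real.pi * x / 2) : ℂ) *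
    (if ∃ n : ℕ, ν = n then
      (1 / (Real.pi : ℂ)) * Complex.log z * besselJ (ν : ℂ) (csqrt z * x)
        - besselYNat ⌊ν⌋₊ (csqrt z * x)
    else
      (1 / (Real.sin (ν * Real.pi) : ℂ)) * besselJ (-(ν : ℂ)) (csqrt z * x))

/-- `Q₁(z,x) = ∫₀ˣ q(y) θ_ν(z,y) ξ_ν(z,y) dy`. -/
def Q₁ (ν : ℝ) (q : ℝ → ℝ) (z : ℂ) (x : ℝ) : ℂ :=
  ∫ y in (0 : ℝ)..x, (q y : ℂ) * theta ν z y * xi ν z y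

/-- `Q₂(z,x) = ∫₀ˣ q(y) ξ_ν(z,y)² dy`. -/
def Q₂ (ν : ℝ) (q : ℝ → ℝ) (z : ℂ) (x : ℝ) : ℂ :=
  ∫ y in (0 : ℝ)..x, (q y : ℂ) * xi ν z y ^ 2

end PerturbedBessel

end

/-! No cancellation between the two terms is used: each is `O(t ^ (-ν - 3/2 - 1/8))`. On positive
reals `J_μ(w)` and the second solution are `w ^ (±μ)` near `0` and `O(w ^ (-1/2))` at infinity, up
to a factor `t ^ (1/8)` that absorbs the `log z` of integer orders. The large-`w` bound needs no
asymptotic expansion: `√w` times a solution satisfies `u'' = (-1 + κ / w ^ 2) u`, whose energy stays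
bounded (`norm_le_of_oscillator`). Power series supply Bessel's equation and the bound near `0`.
Hence `|θ_ν ξ_ν|` and `|ξ_ν ^ 2|` are at most a power of `t` times `x * x ^ (-1/4)`. The factor `x`
turns `q` into `x q`, which lies in `L^2`, as does `x ^ (-1/4)`; Cauchy–Schwarz then bounds both
integrals (`integral_bound_of_majorant`). So `Q₁ = O(t ^ (-1/8))` and `Q₂ = O(t ^ (-2ν - 1/4))`, and
the values of `ξ_{ν+1}` and `θ_{ν+1}` at `a` provide the remaining powers. -/

namespace PerturbedBessel

/-! ### Entire power series and their differential operators -/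

/-- Coefficients that decay at least like `1 / k!`. -/
def FactorialDecay (c : ℕ → ℂ) : Prop := ∃ M : ℝ, ∀ k, ‖c k‖ * k ! ≤ M

/-- The sum of a power series at a real point. -/
noncomputable def powSum (c : ℕ → ℂ) (x : ℝ) : ℂ := ∑' k, c k * (x : ℂ) ^ k

/-- The coefficients of the derivative of a power series. -/
def derivCoeff (c : ℕ → ℂ) (k : ℕ) : ℂ := (k + 1) * c (k + 1)

lemma FactorialDecay.deriv {c : ℕ → ℂ} (hc : FactorialDecay c) :
    FactorialDecay (derivCoeff c) := by
  obtain ⟨M, hM⟩ := hc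
  refine ⟨M, fun k => le_trans (le_of_eq ?_) (hM (k + 1))⟩
  have h : ‖(k : ℂ) + 1‖ = k + 1 := by
    rw [← Nat.cast_succ, Complex.norm_natCast, Nat.cast_succ]
  rw [derivCoeff, norm_mul, h, Nat.factorial_succ]
  push_cast
  ring

lemma FactorialDecay.norm_le {c : ℕ → ℂ} {M : ℝ} (hM : ∀ k, ‖c k‖ * k ! ≤ M) (k : ℕ) :
    ‖c k‖ ≤ M / k ! := by
  rw [le_div_iff₀ (by positivity)]
  exact hM k

lemma FactorialDecay.summable {c : ℕ → ℂ} (hc : FactorialDecay c) (x : ℝ) :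
    Summable fun k => c k * (x : ℂ) ^ k := by
  obtain ⟨M, hM⟩ := hc
  refine Summable.of_norm_bounded ((Real.summable_pow_div_factorial |x|).mul_left M) fun k => ?_
  rw [norm_mul, norm_pow, Complex.norm_real, Real.norm_eq_abs]
  calc ‖c k‖ * |x| ^ k ≤ M / k ! * |x| ^ k := by
        gcongr
        exact FactorialDecay.norm_le hM k
    _ = _ := by ring

lemma hasDerivAt_powSum {c : ℕ → ℂ} (hc : FactorialDecay c) (x : ℝ) :
    HasDerivAt (powSum c) (powSum (derivCoeff c) x) x := by
  have hd := hc.deriv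
  obtain ⟨M, hM⟩ := id hc
  set R : ℝ := |x| + 1 with hR
  have hx : x ∈ Metric.ball (0 : ℝ) R := by simp [hR]
  have hu : Summable fun k : ℕ => M / k ! * (k * R ^ (k - 1)) := by
    rw [← summable_nat_add_iff 1]
    refine ((Real.summable_pow_div_factorial R).mul_left M).congr fun k => ?_
    rw [Nat.factorial_succ]
    push_cast
    have : (k ! : ℝ) ≠ 0 := by positivity
    field_simp
  have h := hasDerivAt_tsum_of_isPreconnected (𝕜 := ℝ)
    (g := fun k (y : ℝ) => c k * (y : ℂ) ^ k)
    (g' := fun k (y : ℝ) => c k * (k * (y : ℂ) ^ (k - 1))) hu Metric.isOpen_ball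
    (convex_ball (0 : ℝ) R).isPreconnected
    (fun k y _ => ((hasDerivAt_pow k (y : ℂ)).comp_ofReal).const_mul (c k))
    (fun k y hy => by
      rw [norm_mul, norm_mul, norm_pow, Complex.norm_real, Complex.norm_natCast]
      rw [mem_ball_zero_iff] at hy
      have hk := FactorialDecay.norm_le hM k
      have hy' := hy.le
      gcongr
      exact (norm_nonneg _).trans hk)
    hx (hc.summable x) hx
  refine HasDerivAt.congr_deriv (f := powSum c) h ?_
  have hs : Summable fun k : ℕ => c k * (k * (x : ℂ) ^ (k - 1)) := by
    rw [← summable_nat_add_iff 1]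
    refine (hd.summable x).congr fun k => ?_
    simp only [derivCoeff, Nat.add_sub_cancel]
    push_cast
    ring
  rw [hs.tsum_eq_zero_add, powSum]
  push_cast
  simp only [zero_mul, mul_zero, zero_add]
  exact tsum_congr fun k => by rw [derivCoeff]; ring

lemma continuous_powSum {c : ℕ → ℂ} (hc : FactorialDecay c) : Continuous (powSum c) :=
  continuous_iff_continuousAt.2 fun x => (hasDerivAt_powSum hc x).continuousAt

lemma mul_powSum_derivCoeff {c : ℕ → ℂ} (hc : FactorialDecay c) (x : ℝ) :
    HasSum (fun k : ℕ => k * c k * (x : ℂ) ^ k) (x * powSum (derivCoeff c) x) := by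
  rw [← hasSum_nat_add_iff' 1]
  simp only [Finset.range_one, Finset.sum_singleton, Nat.cast_zero, zero_mul, sub_zero]
  refine ((hc.deriv.summable x).hasSum.mul_left (x : ℂ)).congr_fun fun k => ?_
  rw [derivCoeff]
  push_cast
  ring

/-- The operator `x f'' + b f' + f` acting on coefficients. -/
lemma hasSum_operator {c : ℕ → ℂ} (hc : FactorialDecay c) (b : ℂ) (x : ℝ) :
    HasSum (fun k : ℕ => ((k + 1) * (k + b) * c (k + 1) + c k) * (x : ℂ) ^ k)
      (x * powSum (derivCoeff (derivCoeff c)) x + b * powSum (derivCoeff c) x + powSum c x) := by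
  refine (((mul_powSum_derivCoeff hc.deriv x).add
    ((hc.deriv.summable x).hasSum.mul_left b)).add (hc.summable x).hasSum).congr_fun fun k => ?_
  rw [derivCoeff]
  ring

/-! ### Boundedness at infinity from the differential equation -/

/-- The energy `E = ‖u‖ ^ 2 + ‖u'‖ ^ 2` changes only through the perturbation `κ / w ^ 2`, so `E' ≤
|κ| E / w ^ 2`. This rate is integrable at infinity, and `E * exp (|κ| / w)` is nonincreasing. -/
lemma norm_le_of_oscillator {u u' u'' : ℝ → ℂ} {κ : ℝ}
    (h1 : ∀ w, 0 < w → HasDerivAt u (u' w) w) (h2 : ∀ w, 0 < w → HasDerivAt u' (u'' w) w)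
    (hu : ∀ w, 0 < w → u'' w = ((-1 + κ / w ^ 2 : ℝ) : ℂ) * u w) :
    ∃ C : ℝ, ∀ w, 1 ≤ w → ‖u w‖ ≤ C := by
  set E : ℝ → ℝ := fun w => ‖u w‖ ^ 2 + ‖u' w‖ ^ 2 with hE
  set F : ℝ → ℝ := fun w => E w * Real.exp (|κ| / w) with hF
  have hE' : ∀ w, 0 < w → HasDerivAt E (2 * (κ / w ^ 2) * inner ℝ (u' w) (u w)) w := by
    intro w hw
    refine ((h1 w hw).norm_sq.add (h2 w hw).norm_sq).congr_deriv ?_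
    rw [hu w hw, ← Complex.real_smul, inner_smul_right, real_inner_comm (u w) (u' w)]
    ring
  have hF' : ∀ w, 0 < w → HasDerivAt F (2 * (κ / w ^ 2) * inner ℝ (u' w) (u w) *
      Real.exp (|κ| / w) + E w * (Real.exp (|κ| / w) * (-|κ| / w ^ 2))) w := by
    intro w hw
    refine (hE' w hw).mul (HasDerivAt.exp ?_)
    have := ((hasDerivAt_inv hw.ne').const_mul |κ|)
    simp only [← div_eq_mul_inv] at this
    exact this.congr_deriv (by ring)
  have hanti : AntitoneOn F (Set.Ici 1) := by
    refine antitoneOn_of_deriv_nonpos (convex_Ici 1)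
      (fun w hw => (hF' w (lt_of_lt_of_le one_pos hw)).continuousAt.continuousWithinAt) ?_ ?_
    · intro w hw
      rw [interior_Ici] at hw
      exact (hF' w (one_pos.trans hw)).differentiableAt.differentiableWithinAt
    · intro w hw
      rw [interior_Ici] at hw
      have hw0 : 0 < w := one_pos.trans hw
      rw [(hF' w hw0).deriv]
      have hk : 2 * (κ * inner ℝ (u' w) (u w)) ≤ |κ| * E w := by
        have h3 : κ * inner ℝ (u' w) (u w) ≤ |κ| * (‖u' w‖ * ‖u w‖) := by
          refine (le_abs_self _).trans ?_
          rw [abs_mul]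
          gcongr
          exact abs_real_inner_le_norm _ _
        have h4 : 2 * (‖u' w‖ * ‖u w‖) ≤ E w := by
          simp only [hE]
          nlinarith [sq_nonneg (‖u' w‖ - ‖u w‖)]
        nlinarith [abs_nonneg κ]
      have : 2 * (κ / w ^ 2) * inner ℝ (u' w) (u w) * Real.exp (|κ| / w) +
          E w * (Real.exp (|κ| / w) * (-|κ| / w ^ 2)) =
          (2 * (κ * inner ℝ (u' w) (u w)) - |κ| * E w) * (Real.exp (|κ| / w) / w ^ 2) := by ring
      rw [this]
      exact mul_nonpos_of_nonpos_of_nonneg (by linarith) (by positivity)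
  refine ⟨Real.sqrt (F 1), fun w hw => Real.le_sqrt_of_sq_le ?_⟩
  have h0 : 0 < w := lt_of_lt_of_le one_pos hw
  calc ‖u w‖ ^ 2 ≤ E w := by simp only [hE]; nlinarith [sq_nonneg ‖u' w‖]
    _ ≤ F w := le_mul_of_one_le_right (by positivity) (Real.one_le_exp (by positivity))
    _ ≤ F 1 := hanti (Set.mem_Ici.2 le_rfl) hw hw

/-- Solutions of Bessel's equation of order `μ`, written as `w ^ μ * H (w ^ 2 / 4)`, are
`O(w ^ (-1/2))` at infinity. -/
lemma norm_le_of_bessel_equation (μ : ℝ) {H H' H'' : ℝ → ℂ}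
    (h1 : ∀ x, 0 < x → HasDerivAt H (H' x) x) (h2 : ∀ x, 0 < x → HasDerivAt H' (H'' x) x)
    (hH : ∀ x : ℝ, 0 < x → x * H'' x + (μ + 1) * H' x + H x = 0) :
    ∃ C : ℝ, ∀ w, 1 ≤ w → w ^ (μ + 1 / 2) * ‖H (w ^ 2 / 4)‖ ≤ C := by
  have hp : ∀ s w : ℝ, 0 < w →
      HasDerivAt (fun w : ℝ => ((w ^ s : ℝ) : ℂ)) ((s * w ^ (s - 1) : ℝ) : ℂ) w := fun s w hw =>
    (Real.hasDerivAt_rpow_const (Or.inl hw.ne')).ofReal_comp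
  have hq : ∀ w : ℝ, HasDerivAt (fun w : ℝ => w ^ 2 / 4) (w / 2) w := fun w =>
    ((hasDerivAt_pow 2 w).div_const 4).congr_deriv (by norm_num; ring)
  have hc : ∀ {G G' : ℝ → ℂ}, (∀ x, 0 < x → HasDerivAt G (G' x) x) → ∀ w : ℝ, 0 < w →
      HasDerivAt (fun w : ℝ => G (w ^ 2 / 4)) (((w / 2 : ℝ) : ℂ) * G' (w ^ 2 / 4)) w := by
    intro G G' hG w hw
    have := (hG (w ^ 2 / 4) (by positivity)).scomp w (hq w)
    rwa [Complex.real_smul] at this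
  -- Liouville's substitution: multiplying the solution by `√w` removes the first-order term and
  -- leaves the potential `(μ ^ 2 - 1/4) / w ^ 2`.
  obtain ⟨C, hC⟩ := norm_le_of_oscillator (κ := μ ^ 2 - 1 / 4)
    (u := fun w => ((w ^ (μ + 1 / 2) : ℝ) : ℂ) * H (w ^ 2 / 4))
    (u' := fun w => (((μ + 1 / 2) * w ^ (μ - 1 / 2) : ℝ) : ℂ) * H (w ^ 2 / 4) +
      ((w ^ (μ + 3 / 2) / 2 : ℝ) : ℂ) * H' (w ^ 2 / 4))
    (u'' := fun w => ((-1 + (μ ^ 2 - 1 / 4) / w ^ 2 : ℝ) : ℂ) *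
      (((w ^ (μ + 1 / 2) : ℝ) : ℂ) * H (w ^ 2 / 4)))
    (fun w hw => by
      refine ((hp _ w hw).mul (hc h1 w hw)).congr_deriv ?_
      have e1 : w ^ (μ + 3 / 2) = w ^ (μ + 1 / 2) * w := by
        rw [← Real.rpow_add_one hw.ne']; ring_nf
      rw [e1, show μ + 1 / 2 - 1 = μ - 1 / 2 by ring]
      push_cast
      ring)
    (fun w hw => by
      have hd := ((((hp (μ - 1 / 2) w hw).const_mul ((μ + 1 / 2 : ℝ) : ℂ)).mul (hc h1 w hw)).add
        (((hp (μ + 3 / 2) w hw).div_const 2).mul (hc h2 w hw)))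
      simp only [← Complex.ofReal_mul] at hd
      refine (hd.congr_deriv ?_).congr_of_eventuallyEq ?_
      · have hw' : (w : ℂ) ≠ 0 := by exact_mod_cast hw.ne'
        have e0 : w ^ (μ - 1 / 2) = w ^ (μ - 1 / 2 - 1) * w := by
          rw [← Real.rpow_add_one hw.ne']; ring_nf
        have e1 : w ^ (μ + 1 / 2) = w ^ (μ - 1 / 2 - 1) * w ^ 2 := by
          rw [← Real.rpow_add_natCast hw.ne']; push_cast; ring_nf
        have e2 : w ^ (μ + 3 / 2) = w ^ (μ - 1 / 2 - 1) * w ^ 3 := by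
          rw [← Real.rpow_add_natCast hw.ne']; push_cast; ring_nf
        have hode := hH (w ^ 2 / 4) (by positivity)
        rw [show μ + 3 / 2 - 1 = μ + 1 / 2 by ring, e2, e1, e0]
        push_cast at hode ⊢
        generalize ((w ^ (μ - 1 / 2 - 1) : ℝ) : ℂ) = P
        field_simp
        linear_combination (16 * P * w ^ 2) * hode
      · refine Filter.Eventually.of_forall fun w => ?_
        simp)
    (fun w hw => rfl)
  refine ⟨C, fun w hw => ?_⟩
  have h0 : 0 < w := lt_of_lt_of_le one_pos hw
  have := hC w hw
  rwa [norm_mul, Complex.norm_real, Real.norm_of_nonneg (by positivity)] at this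

/-! ### The series of `J_μ` in the variable `x = w ^ 2 / 4` -/

/-- The coefficients of `∑ (-x)^k / (k! Γ(μ + k + 1))`. -/
noncomputable def jCoeff (μ : ℝ) (k : ℕ) : ℂ :=
  (-1) ^ k * ((k ! : ℂ) * Complex.Gamma (μ + k + 1))⁻¹

/-- For the reciprocal of `Γ` the functional equation also holds at the poles, so no order has to be
excluded. -/
lemma inv_Gamma_recurrence (μ : ℝ) (k : ℕ) :
    (Complex.Gamma (μ + k + 1))⁻¹ =
      (μ + k + 1) * (Complex.Gamma (μ + (k + 1 : ℕ) + 1))⁻¹ := by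
  rw [Complex.one_div_Gamma_eq_self_mul_one_div_Gamma_add_one]
  push_cast
  ring_nf

/-- From `K ≥ -μ` on, the factor `μ + k + 1` of the recurrence is at least `1` and the sequence no
longer increases; finitely many terms precede. -/
lemma exists_norm_inv_Gamma_le (μ : ℝ) :
    ∃ M : ℝ, ∀ k : ℕ, ‖(Complex.Gamma (μ + k + 1))⁻¹‖ ≤ M := by
  set d : ℕ → ℝ := fun k => ‖(Complex.Gamma (μ + k + 1))⁻¹‖ with hd
  obtain ⟨K, hK⟩ := exists_nat_ge (-μ)
  have hstep : ∀ j, d (K + j) ≤ d K := by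
    intro j
    induction j with
    | zero => exact le_rfl
    | succ j ih =>
      refine le_trans ?_ ih
      have h1 : (1 : ℝ) ≤ ‖((μ + (K + j : ℕ) + 1 : ℝ) : ℂ)‖ := by
        rw [Complex.norm_real, Real.norm_eq_abs]
        refine le_trans ?_ (le_abs_self _)
        push_cast
        have : (0 : ℝ) ≤ j := by positivity
        linarith
      have h2 : d (K + j) = ‖((μ + (K + j : ℕ) + 1 : ℝ) : ℂ)‖ * d (K + j + 1) := by
        simp only [hd]
        rw [inv_Gamma_recurrence, norm_mul]
        push_cast
        rfl
      rw [h2]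
      exact le_mul_of_one_le_left (norm_nonneg _) h1
  refine ⟨∑ k ∈ Finset.range (K + 1), d k, fun k => ?_⟩
  have hs : ∀ k ≤ K, d k ≤ ∑ k ∈ Finset.range (K + 1), d k := fun k hk =>
    Finset.single_le_sum (f := d) (fun _ _ => norm_nonneg _) (by simpa [Nat.lt_succ_iff] using hk)
  rcases le_total k K with h | h
  · exact hs k h
  · obtain ⟨j, rfl⟩ := Nat.exists_eq_add_of_le h
    exact (hstep j).trans (hs K le_rfl)

lemma factorialDecay_jCoeff (μ : ℝ) : FactorialDecay (jCoeff μ) := by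
  obtain ⟨M, hM⟩ := exists_norm_inv_Gamma_le μ
  refine ⟨M, fun k => le_trans (le_of_eq ?_) (hM k)⟩
  have : (k ! : ℝ) ≠ 0 := by positivity
  rw [jCoeff, mul_inv, norm_mul, norm_mul, norm_pow, norm_neg, norm_one, one_pow, norm_inv,
    Complex.norm_natCast]
  field_simp

lemma jCoeff_recurrence (μ : ℝ) (k : ℕ) :
    (k + 1) * (k + (μ + 1)) * jCoeff μ (k + 1) + jCoeff μ k = 0 := by
  have : (k ! : ℂ) ≠ 0 := Nat.cast_ne_zero.2 (Nat.factorial_ne_zero k)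
  have : (k + 1 : ℂ) ≠ 0 := by exact_mod_cast Nat.succ_ne_zero k
  simp only [jCoeff, mul_inv]
  rw [inv_Gamma_recurrence μ k, Nat.factorial_succ]
  push_cast
  field_simp
  ring

lemma jCoeff_natCast (n k : ℕ) :
    jCoeff n k = (-1) ^ k * ((k ! : ℂ) * ((n + k)! : ℂ))⁻¹ := by
  rw [jCoeff, ← Complex.Gamma_nat_eq_factorial (n + k)]
  push_cast
  rfl

lemma jCoeff_equation (μ x : ℝ) :
    x * powSum (derivCoeff (derivCoeff (jCoeff μ))) x +
      (μ + 1) * powSum (derivCoeff (jCoeff μ)) x + powSum (jCoeff μ) x = 0 := by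
  refine (hasSum_operator (factorialDecay_jCoeff μ) (μ + 1) x).unique ?_
  simp only [jCoeff_recurrence, zero_mul]
  exact hasSum_zero

lemma besselJ_ofReal (μ : ℝ) {w : ℝ} (hw : 0 < w) :
    besselJ μ w = (((w / 2) ^ μ : ℝ) : ℂ) * powSum (jCoeff μ) (w ^ 2 / 4) := by
  rw [besselJ, Complex.ofReal_cpow (by positivity), powSum]
  push_cast
  congr 1
  refine tsum_congr fun k => ?_
  rw [jCoeff, neg_pow]
  ring

/-! ### Two-regime bounds for `J_μ` -/

/-- The common size of a solution of Bessel's equation that behaves like `w ^ s` at `0`. -/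
noncomputable def envelope (s w : ℝ) : ℝ := if w ≤ 1 then w ^ s else w ^ (-1 / 2 : ℝ)

lemma envelope_nonneg (s : ℝ) {w : ℝ} (hw : 0 < w) : 0 ≤ envelope s w := by
  rw [envelope]
  split_ifs <;> positivity

lemma exists_envelope_bound {h : ℝ → ℂ} {s : ℝ}
    (h0 : ∃ C, ∀ w, 0 < w → w ≤ 1 → ‖h w‖ ≤ C * w ^ s)
    (h1 : ∃ C, ∀ w, 1 ≤ w → w ^ (1 / 2 : ℝ) * ‖h w‖ ≤ C) :
    ∃ C, 0 ≤ C ∧ ∀ w, 0 < w → ‖h w‖ ≤ C * envelope s w := by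
  obtain ⟨A, hA⟩ := h0
  obtain ⟨B, hB⟩ := h1
  refine ⟨|A| + |B|, by positivity, fun w hw => ?_⟩
  rw [envelope]
  split_ifs with h
  · refine (hA w hw h).trans ?_
    gcongr
    exact (le_abs_self A).trans (le_add_of_nonneg_right (abs_nonneg B))
  · have := hB w (not_le.1 h).le
    have hp : 0 < w ^ (1 / 2 : ℝ) := by positivity
    rw [show (-1 / 2 : ℝ) = -(1 / 2) by norm_num, Real.rpow_neg hw.le, ← div_eq_mul_inv,
      le_div_iff₀ hp, mul_comm]
    exact this.trans ((le_abs_self B).trans (le_add_of_nonneg_left (abs_nonneg A)))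

lemma exists_norm_powSum_le {c : ℕ → ℂ} (hc : FactorialDecay c) :
    ∃ C : ℝ, ∀ x : ℝ, 0 ≤ x → x ≤ 1 → ‖powSum c x‖ ≤ C := by
  obtain ⟨C, hC⟩ := (isCompact_Icc (a := (0 : ℝ)) (b := 1)).exists_bound_of_continuousOn
    (continuous_powSum hc).continuousOn
  exact ⟨C, fun x h0 h1 => hC x ⟨h0, h1⟩⟩

/-- The form of `norm_le_of_bessel_equation` for functions `c * (w / 2) ^ μ * H (w ^ 2 / 4)`. -/
lemma exists_mul_norm_le (μ : ℝ) {h H H' H'' : ℝ → ℂ} (c : ℂ)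
    (hh : ∀ w : ℝ, 0 < w → h w = c * (((w / 2) ^ μ : ℝ) : ℂ) * H (w ^ 2 / 4))
    (h1 : ∀ x, 0 < x → HasDerivAt H (H' x) x) (h2 : ∀ x, 0 < x → HasDerivAt H' (H'' x) x)
    (hH : ∀ x : ℝ, 0 < x → x * H'' x + (μ + 1) * H' x + H x = 0) :
    ∃ C, ∀ w, 1 ≤ w → w ^ (1 / 2 : ℝ) * ‖h w‖ ≤ C := by
  obtain ⟨C, hC⟩ := norm_le_of_bessel_equation μ h1 h2 hH
  refine ⟨‖c‖ / 2 ^ μ * C, fun w hw => ?_⟩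
  have h0 : 0 < w := lt_of_lt_of_le one_pos hw
  rw [hh w h0, norm_mul, norm_mul, Complex.norm_real, Real.norm_of_nonneg (by positivity),
    Real.div_rpow h0.le zero_le_two]
  have := hC w hw
  rw [Real.rpow_add h0] at this
  calc _ = ‖c‖ / 2 ^ μ * (w ^ μ * w ^ (1 / 2 : ℝ) * ‖H (w ^ 2 / 4)‖) := by ring
    _ ≤ _ := by gcongr

lemma exists_norm_besselJ_le (μ : ℝ) :
    ∃ C, 0 ≤ C ∧ ∀ w : ℝ, 0 < w → ‖besselJ μ w‖ ≤ C * envelope μ w := by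
  have hd := factorialDecay_jCoeff μ
  refine exists_envelope_bound (h := fun w : ℝ => besselJ μ w) ?_ ?_
  · obtain ⟨C, hC⟩ := exists_norm_powSum_le hd
    refine ⟨C / 2 ^ μ, fun w hw hw1 => ?_⟩
    rw [besselJ_ofReal μ hw, norm_mul, Complex.norm_real, Real.norm_of_nonneg (by positivity),
      Real.div_rpow hw.le zero_le_two]
    calc _ ≤ w ^ μ / 2 ^ μ * C := by
          gcongr
          exact hC _ (by positivity) (by nlinarith)
      _ = _ := by ring
  · exact exists_mul_norm_le μ 1 (fun w hw => by rw [besselJ_ofReal μ hw, one_mul])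
      (fun x _ => hasDerivAt_powSum hd x) (fun x _ => hasDerivAt_powSum hd.deriv x)
      (fun x _ => jCoeff_equation μ x)

lemma continuousOn_besselJ (μ : ℝ) :
    ContinuousOn (fun w : ℝ => besselJ μ w) (Set.Ioi 0) := by
  have h : ContinuousOn (fun w : ℝ => (((w / 2) ^ μ : ℝ) : ℂ) * powSum (jCoeff μ) (w ^ 2 / 4))
      (Set.Ioi 0) := by
    refine ContinuousOn.mul (Complex.continuous_ofReal.comp_continuousOn ?_) ?_
    · exact ContinuousOn.rpow_const (by fun_prop) fun w hw => Or.inl (half_pos hw).ne'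
    · exact ((continuous_powSum (factorialDecay_jCoeff μ)).comp (by fun_prop)).continuousOn
  exact h.congr fun w hw => besselJ_ofReal μ hw

/-! ### The Neumann function of integer order -/

/-- The coefficients of the finite sum in `Y_n`. -/
noncomputable def polarCoeff (n k : ℕ) : ℂ := if k < n then ((n - k - 1)! : ℂ) / (k ! : ℂ) else 0

/-- The coefficients of the digamma series in `Y_n`. -/
noncomputable def digammaCoeff (n k : ℕ) : ℂ :=
  (Complex.digamma (k + 1) + Complex.digamma (n + k + 1)) * jCoeff n k

lemma factorialDecay_polarCoeff (n : ℕ) : FactorialDecay (polarCoeff n) := by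
  refine ⟨n !, fun k => ?_⟩
  rw [polarCoeff]
  split_ifs
  · rw [norm_div, Complex.norm_natCast, Complex.norm_natCast, div_mul_cancel₀ _ (by positivity)]
    exact_mod_cast Nat.factorial_le (by omega)
  · simp

lemma digamma_natCast_add_two (k : ℕ) :
    Complex.digamma ((k + 1 : ℕ) + 1) = Complex.digamma (k + 1) + (k + 1 : ℂ)⁻¹ := by
  have := Complex.digamma_apply_add_one (k + 1) (fun m h => by
    have h' : ((k + 1 + m : ℕ) : ℂ) = 0 := by push_cast; rw [h]; ring
    exact absurd (Nat.cast_eq_zero.1 h') (by omega))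
  push_cast
  rw [this]

lemma exists_norm_digamma_le :
    ∃ A, 0 ≤ A ∧ ∀ k : ℕ, ‖Complex.digamma (k + 1)‖ ≤ A * (k + 1) := by
  refine ⟨‖Complex.digamma 1‖ + 1, by positivity, fun k => ?_⟩
  induction k with
  | zero => simp
  | succ k ih =>
    rw [digamma_natCast_add_two]
    have h : ‖(k + 1 : ℂ)⁻¹‖ ≤ 1 := by
      rw [norm_inv, ← Nat.cast_succ, Complex.norm_natCast]
      exact inv_le_one_of_one_le₀ (by simp)
    refine (norm_add_le _ _).trans ((add_le_add ih h).trans ?_)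
    push_cast
    nlinarith [norm_nonneg (Complex.digamma 1)]

/-- `jCoeff n` contains two factorials: `(n + k)!` pays for the linear growth of the digamma values
and `k !` remains. -/
lemma factorialDecay_digammaCoeff (n : ℕ) : FactorialDecay (digammaCoeff n) := by
  obtain ⟨A, hA0, hA⟩ := exists_norm_digamma_le
  refine ⟨4 * A, fun k => ?_⟩
  have h1 := hA k
  have h2 := hA (n + k)
  push_cast at h2
  rw [digammaCoeff, jCoeff_natCast, norm_mul, norm_mul, norm_inv, norm_mul, norm_pow, norm_neg,
    norm_one, one_pow, Complex.norm_natCast, Complex.norm_natCast]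
  have hk : (0 : ℝ) < k ! := by positivity
  have hm : (0 : ℝ) < (n + k)! := by positivity
  have h3 : (n + k + 1 : ℝ) ≤ 2 * (n + k)! := by
    have := Nat.self_le_factorial (n + k)
    have := Nat.factorial_pos (n + k)
    exact_mod_cast (by omega : n + k + 1 ≤ 2 * (n + k)!)
  have h4 : ‖Complex.digamma (k + 1) + Complex.digamma (n + k + 1)‖ ≤ 4 * A * (n + k)! := by
    refine (norm_add_le _ _).trans ((add_le_add h1 h2).trans ?_)
    have : (0 : ℝ) ≤ n := by positivity
    nlinarith
  field_simp
  linarith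

/-- This is the equation of order `-n`. Its recurrence holds at every index except `n - 1`, where
the truncation leaves one monomial. -/
lemma polarCoeff_equation {n : ℕ} (hn : 0 < n) (x : ℝ) :
    x * powSum (derivCoeff (derivCoeff (polarCoeff n))) x +
      (1 - n) * powSum (derivCoeff (polarCoeff n)) x + powSum (polarCoeff n) x =
      (x : ℂ) ^ (n - 1) / ((n - 1)! : ℂ) := by
  refine (hasSum_operator (factorialDecay_polarCoeff n) (1 - n) x).unique ?_
  convert hasSum_single (n - 1) fun k hk => ?_ using 1
  · rw [polarCoeff, polarCoeff, if_neg (by omega), if_pos (by omega),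
      show n - (n - 1) - 1 = 0 by omega]
    simp
    ring
  · refine mul_eq_zero_of_left ?_ _
    rcases lt_or_ge k n with h | h
    · obtain ⟨m, rfl⟩ : ∃ m, n = k + m + 2 := ⟨n - k - 2, by omega⟩
      rw [polarCoeff, polarCoeff, if_pos (by omega), if_pos (by omega),
        show k + m + 2 - (k + 1) - 1 = m by omega, show k + m + 2 - k - 1 = m + 1 by omega,
        Nat.factorial_succ, Nat.factorial_succ]
      have : (k ! : ℂ) ≠ 0 := Nat.cast_ne_zero.2 (Nat.factorial_ne_zero k)
      have : (k + 1 : ℂ) ≠ 0 := by exact_mod_cast Nat.succ_ne_zero k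
      push_cast
      field_simp
      ring
    · rw [polarCoeff, polarCoeff, if_neg (by omega), if_neg (by omega)]
      simp

/-- The digamma increments `1/(k+1) + 1/(n+k+1)`, times `(k+1)(n+k+1)`, give `n + 2(k+1)`: the
coefficient weights of `n f + 2 x f'`. The extra factor `x` shifts the index by one, so the constant
term `1/(n-1)!` has to be subtracted. -/
lemma digammaCoeff_equation {n : ℕ} (hn : 0 < n) (x : ℝ) :
    x * (x * powSum (derivCoeff (derivCoeff (digammaCoeff n))) x +
      (n + 1) * powSum (derivCoeff (digammaCoeff n)) x + powSum (digammaCoeff n) x) =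
      n * powSum (jCoeff n) x + 2 * (x * powSum (derivCoeff (jCoeff n)) x) -
        1 / ((n - 1)! : ℂ) := by
  have hd := factorialDecay_jCoeff n
  refine ((hasSum_operator (factorialDecay_digammaCoeff n) (n + 1) x).mul_left (x : ℂ)).unique ?_
  have h := ((hd.summable x).hasSum.mul_left (n : ℂ)).add
    ((mul_powSum_derivCoeff hd x).mul_left 2)
  rw [← hasSum_nat_add_iff' 1] at h
  simp only [Finset.range_one, Finset.sum_singleton] at h
  have h0 : (n : ℂ) * jCoeff n 0 = 1 / ((n - 1)! : ℂ) := by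
    obtain ⟨m, rfl⟩ := Nat.exists_eq_add_of_lt hn
    have : ((m ! : ℕ) : ℂ) ≠ 0 := Nat.cast_ne_zero.2 (Nat.factorial_ne_zero m)
    have : (m + 1 : ℂ) ≠ 0 := by exact_mod_cast Nat.succ_ne_zero m
    rw [jCoeff_natCast]
    simp [Nat.factorial_succ]
    field_simp
  have hv : (n : ℂ) * powSum (jCoeff n) x + 2 * (x * powSum (derivCoeff (jCoeff n)) x) -
      1 / ((n - 1)! : ℂ) = n * ∑' k, jCoeff n k * (x : ℂ) ^ k +
      2 * (x * powSum (derivCoeff (jCoeff n)) x) -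
      (n * (jCoeff n 0 * (x : ℂ) ^ 0) + 2 * ((0 : ℕ) * jCoeff n 0 * (x : ℂ) ^ 0)) := by
    rw [← h0, powSum]
    push_cast
    ring
  rw [hv]
  refine h.congr_fun fun k => ?_
  · have e1 := digamma_natCast_add_two k
    have e2 := digamma_natCast_add_two (n + k)
    have e3 := jCoeff_recurrence n k
    have hk : (k + 1 : ℂ) ≠ 0 := by exact_mod_cast Nat.succ_ne_zero k
    have hm : (n + k + 1 : ℂ) ≠ 0 := by exact_mod_cast Nat.succ_ne_zero (n + k)
    rw [digammaCoeff, digammaCoeff]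
    push_cast at e1 e2 e3 ⊢
    rw [show (n + (k + 1) + 1 : ℂ) = n + k + 1 + 1 by ring, e1, e2,
      show jCoeff n k = -((k + 1) * (k + (n + 1)) * jCoeff n (k + 1)) by linear_combination e3]
    field_simp
    ring

/-- The function `H` with `Y_n(w) = π⁻¹ (w/2)^n H(w²/4)`. -/
noncomputable def yProfile (n : ℕ) (x : ℝ) : ℂ :=
  (Real.log x : ℂ) * powSum (jCoeff n) x - (x : ℂ) ^ (-n : ℤ) * powSum (polarCoeff n) x -
    powSum (digammaCoeff n) x

lemma besselYNat_ofReal (n : ℕ) {w : ℝ} (hw : 0 < w) :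
    besselYNat n w =
      (1 / (Real.pi : ℂ)) * (((w / 2) ^ (n : ℝ) : ℝ) : ℂ) * yProfile n (w ^ 2 / 4) := by
  have hJ := besselJ_ofReal n hw
  have hp : powSum (polarCoeff n) (w ^ 2 / 4) =
      ∑ k ∈ Finset.range n, (((n - k - 1)! : ℕ) : ℂ) / (k ! : ℂ) * ((w : ℂ) ^ 2 / 4) ^ k := by
    rw [powSum, tsum_eq_sum (s := Finset.range n)]
    · refine Finset.sum_congr rfl fun k hk => ?_
      rw [polarCoeff, if_pos (Finset.mem_range.1 hk)]
      push_cast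
      rfl
    · intro k hk
      rw [polarCoeff, if_neg (by simpa using hk), zero_mul]
  have hg : powSum (digammaCoeff n) (w ^ 2 / 4) =
      ∑' k : ℕ, (Complex.digamma (k + 1) + Complex.digamma (n + k + 1)) *
          (-((w : ℂ) ^ 2 / 4)) ^ k / ((k ! : ℂ) * ((n + k)! : ℂ)) := by
    refine tsum_congr fun k => ?_
    rw [digammaCoeff, jCoeff_natCast, neg_pow ((w : ℂ) ^ 2 / 4)]
    push_cast
    ring
  have hl : Complex.log ((w : ℂ) / 2) = ((Real.log (w / 2) : ℝ) : ℂ) := by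
    rw [Complex.ofReal_log (by positivity)]
    push_cast
    rfl
  have hl2 : Real.log (w ^ 2 / 4) = 2 * Real.log (w / 2) := by
    rw [show w ^ 2 / 4 = (w / 2) ^ 2 by ring, Real.log_pow]
    push_cast
    rfl
  push_cast at hJ
  rw [besselYNat, hJ, ← hp, ← hg, yProfile, hl, hl2, Real.rpow_natCast, zpow_neg, zpow_natCast]
  have hw' : (w : ℂ) ≠ 0 := by exact_mod_cast hw.ne'
  have e : ((w : ℂ) / 2) ^ n * (((w ^ 2 / 4 : ℝ) : ℂ) ^ n)⁻¹ = (((w : ℂ) / 2) ^ n)⁻¹ := by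
    rw [← inv_pow, ← mul_pow, ← inv_pow]
    congr 1
    push_cast
    field_simp
    norm_num
  rw [← e]
  push_cast
  ring

/-- Near `0` the polar part dominates, since `x ^ n * |log x|` stays bounded for `n ≥ 1`. At
infinity only the differential equation of `yProfile` matters. -/
lemma exists_norm_besselYNat_le {n : ℕ} (hn : 0 < n) :
    ∃ C, 0 ≤ C ∧ ∀ w : ℝ, 0 < w → ‖besselYNat n w‖ ≤ C * envelope (-n) w := by
  have hf := factorialDecay_jCoeff n
  have hp := factorialDecay_polarCoeff n
  have hg := factorialDecay_digammaCoeff n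
  refine exists_envelope_bound (h := fun w : ℝ => besselYNat n w) ?_ ?_
  · obtain ⟨F, hF⟩ := exists_norm_powSum_le hf
    obtain ⟨P, hP⟩ := exists_norm_powSum_le hp
    obtain ⟨G, hG⟩ := exists_norm_powSum_le hg
    refine ⟨1 / Real.pi * 2 ^ n * (F + P + G), fun w hw hw1 => ?_⟩
    set x : ℝ := w ^ 2 / 4 with hx
    have hx0 : 0 < x := by positivity
    have hx1 : x ≤ 1 := by rw [hx]; nlinarith
    have hxn : x ^ n ≤ x := pow_le_of_le_one hx0.le hx1 hn.ne'
    have key : x ^ n * ‖yProfile n x‖ ≤ F + P + G := by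
      have hl : x ^ n * |Real.log x| ≤ 1 := by
        have := (Real.abs_log_mul_self_lt x hx0 hx1).le
        rw [abs_mul, abs_of_pos hx0] at this
        nlinarith [abs_nonneg (Real.log x)]
      have hb : ‖yProfile n x‖ ≤ |Real.log x| * ‖powSum (jCoeff n) x‖ +
          (x ^ n)⁻¹ * ‖powSum (polarCoeff n) x‖ + ‖powSum (digammaCoeff n) x‖ := by
        rw [yProfile]
        refine (norm_sub_le _ _).trans (add_le_add_left ((norm_sub_le _ _).trans (le_of_eq ?_)) _)
        rw [norm_mul, norm_mul, zpow_neg, zpow_natCast, norm_inv, norm_pow, Complex.norm_real,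
          Complex.norm_real, Real.norm_eq_abs, Real.norm_eq_abs, abs_of_pos hx0]
      calc x ^ n * ‖yProfile n x‖ ≤ x ^ n * (|Real.log x| * ‖powSum (jCoeff n) x‖ +
          (x ^ n)⁻¹ * ‖powSum (polarCoeff n) x‖ + ‖powSum (digammaCoeff n) x‖) := by gcongr
        _ = (x ^ n * |Real.log x|) * ‖powSum (jCoeff n) x‖ + ‖powSum (polarCoeff n) x‖ +
            x ^ n * ‖powSum (digammaCoeff n) x‖ := by
          field_simp
        _ ≤ 1 * F + P + 1 * G := by
          have := hF x hx0.le hx1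
          have := hP x hx0.le hx1
          have := hG x hx0.le hx1
          gcongr
          exact hxn.trans hx1
        _ = F + P + G := by ring
    have e : (w / 2) ^ n = 2 ^ n * w ^ (-n : ℝ) * x ^ n := by
      rw [Real.rpow_neg hw.le, Real.rpow_natCast, hx, ← inv_pow, ← mul_pow, ← mul_pow]
      congr 1
      field_simp
      norm_num
    rw [besselYNat_ofReal n hw, norm_mul, norm_mul, Complex.norm_real, norm_div, norm_one,
      Complex.norm_real, Real.norm_of_nonneg Real.pi_pos.le, Real.norm_of_nonneg (by positivity),
      Real.rpow_natCast, e]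
    calc _ = 1 / Real.pi * 2 ^ n * w ^ (-n : ℝ) * (x ^ n * ‖yProfile n x‖) := by ring
      _ ≤ 1 / Real.pi * 2 ^ n * w ^ (-n : ℝ) * (F + P + G) := by gcongr
      _ = _ := by ring
  · have hz : ∀ (m : ℤ) (x : ℝ), 0 < x →
        HasDerivAt (fun x : ℝ => (x : ℂ) ^ m) (m * (x : ℂ) ^ (m - 1)) x := fun m x hx =>
      (hasDerivAt_zpow m (x : ℂ) (Or.inl (by exact_mod_cast hx.ne'))).comp_ofReal
    have hl : ∀ x : ℝ, 0 < x →
        HasDerivAt (fun x : ℝ => (Real.log x : ℂ)) ((x : ℂ) ^ (-1 : ℤ)) x := fun x hx =>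
      (Real.hasDerivAt_log hx.ne').ofReal_comp.congr_deriv (by simp)
    refine exists_mul_norm_le n (1 / (Real.pi : ℂ)) (H := yProfile n)
      (fun w hw => besselYNat_ofReal n hw)
      (fun x hx => (((hl x hx).mul (hasDerivAt_powSum hf x)).sub
        ((hz _ x hx).mul (hasDerivAt_powSum hp x))).sub (hasDerivAt_powSum hg x))
      (fun x hx => ((((hz _ x hx).mul (hasDerivAt_powSum hf x)).add
        ((hl x hx).mul (hasDerivAt_powSum hf.deriv x))).sub
        ((((hz _ x hx).const_mul _).mul (hasDerivAt_powSum hp x)).add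
        ((hz _ x hx).mul (hasDerivAt_powSum hp.deriv x)))).sub (hasDerivAt_powSum hg.deriv x))
      (fun x hx => ?_)
    have hx' : (x : ℂ) ≠ 0 := by exact_mod_cast hx.ne'
    have e1 := jCoeff_equation n x
    have e2 := polarCoeff_equation hn x
    have e3 := digammaCoeff_equation hn x
    have z2 : (x : ℂ) ^ (-n - 1 : ℤ) = (x : ℂ) ^ (-n - 1 - 1 : ℤ) * x := by
      rw [← zpow_add_one₀ hx']; ring_nf
    have z1 : (x : ℂ) ^ (-n : ℤ) = (x : ℂ) ^ (-n - 1 - 1 : ℤ) * x ^ 2 := by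
      rw [← zpow_natCast, ← zpow_add₀ hx']; push_cast; ring_nf
    have z0 : (x : ℂ) ^ (-n - 1 - 1 : ℤ) * x ^ (n - 1) = (x : ℂ)⁻¹ ^ 3 := by
      rw [← zpow_natCast, ← zpow_add₀ hx', Nat.cast_sub hn, inv_pow, ← zpow_natCast, ← zpow_neg]
      push_cast
      ring_nf
    have z3 : (x : ℂ) ^ (-2 : ℤ) = (x : ℂ)⁻¹ ^ 2 := by
      rw [inv_pow, ← zpow_natCast, ← zpow_neg]
      rfl
    have hi : (x : ℂ) * (x : ℂ)⁻¹ = 1 := mul_inv_cancel₀ hx'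
    simp only [yProfile]
    push_cast at e1 e2 e3 ⊢
    rw [z1, z2, z3, zpow_neg_one]
    generalize (x : ℂ) ^ (-n - 1 - 1 : ℤ) = Z at *
    generalize (x : ℂ)⁻¹ = i at *
    -- With `f = powSum (jCoeff n)`, the logarithmic part leaves `2 f' + n f / x`, the polar part `1
    -- / (x (n-1)!)`, and the digamma part the difference of the two, so the residues cancel.
    linear_combination (Real.log x : ℂ) * e1 - Z * x ^ 2 * e2 - i * e3 -
      x ^ 2 / ((n - 1)! : ℂ) * z0 +
      (x * powSum (derivCoeff (derivCoeff (digammaCoeff n))) x +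
        (n + 1) * powSum (derivCoeff (digammaCoeff n)) x + powSum (digammaCoeff n) x -
        i * powSum (jCoeff n) x - i / ((n - 1)! : ℂ) * (x * i + 1)) * hi

lemma continuousOn_besselYNat (n : ℕ) :
    ContinuousOn (fun w : ℝ => besselYNat n w) (Set.Ioi 0) := by
  have hf := continuous_powSum (factorialDecay_jCoeff n)
  have hp := continuous_powSum (factorialDecay_polarCoeff n)
  have hg := continuous_powSum (factorialDecay_digammaCoeff n)
  have hy : ContinuousOn (yProfile n) (Set.Ioi 0) := by
    refine ((ContinuousOn.mul ?_ hf.continuousOn).sub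
      (ContinuousOn.mul ?_ hp.continuousOn)).sub hg.continuousOn
    · exact Complex.continuous_ofReal.comp_continuousOn
        (Real.continuousOn_log.mono fun x (hx : 0 < x) => hx.ne')
    · exact ContinuousOn.zpow₀ (by fun_prop) _ fun x (hx : 0 < x) =>
        Or.inl (by exact_mod_cast hx.ne')
  have h : ContinuousOn (fun w : ℝ => (1 / (Real.pi : ℂ)) * (((w / 2) ^ (n : ℝ) : ℝ) : ℂ) *
      yProfile n (w ^ 2 / 4)) (Set.Ioi 0) := by
    refine ContinuousOn.mul (continuousOn_const.mul
      (Complex.continuous_ofReal.comp_continuousOn ?_)) ?_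
    · exact ContinuousOn.rpow_const (by fun_prop) fun w hw => Or.inl (half_pos hw).ne'
    · exact hy.comp (by fun_prop) fun w (hw : 0 < w) =>
        Set.mem_Ioi.2 (by positivity : 0 < w ^ 2 / 4)
  exact h.congr fun w hw => besselYNat_ofReal n hw

/-! ### The second solution and the algebra of envelopes -/

open Classical in
/-- The factor of `θ_μ(z, x)` that solves Bessel's equation, as a function of `w = √z x`. -/
noncomputable def secondBessel (μ : ℝ) (z w : ℂ) : ℂ :=
  if ∃ n : ℕ, μ = n then
    (1 / (Real.pi : ℂ)) * Complex.log z * besselJ (μ : ℂ) w - besselYNat ⌊μ⌋₊ w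
  else
    (1 / (Real.sin (μ * Real.pi) : ℂ)) * besselJ (-(μ : ℂ)) w

lemma envelope_le_envelope_neg {s w : ℝ} (hs : 0 ≤ s) (hw : 0 < w) :
    envelope s w ≤ envelope (-s) w := by
  rw [envelope, envelope]
  split_ifs with h
  · exact Real.rpow_le_rpow_of_exponent_ge hw h (by linarith)
  · exact le_rfl

/-- The product is `1` up to `w = 1` and `w⁻¹` beyond. A single power lets `w = t * x` split; the
exponent `-1/4` keeps `x ^ (-1/4)` in `L^2` near `0` and still outweighs the loss `t ^ (1/8)`. -/
lemma envelope_mul_envelope_neg_le (s : ℝ) {w : ℝ} (hw : 0 < w) :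
    envelope s w * envelope (-s) w ≤ w ^ (-1 / 4 : ℝ) := by
  rw [envelope, envelope]
  split_ifs with h
  · rw [← Real.rpow_add hw, add_neg_cancel, Real.rpow_zero]
    exact Real.one_le_rpow_of_pos_of_le_one_of_nonpos hw h (by norm_num)
  · rw [← Real.rpow_add hw]
    exact Real.rpow_le_rpow_of_exponent_le (not_le.1 h).le (by norm_num)

lemma exists_envelope_le (s : ℝ) {a : ℝ} (ha : 0 < a) :
    ∃ D, 0 ≤ D ∧ ∀ t, 1 ≤ t → envelope s (t * a) ≤ D * t ^ (-1 / 2 : ℝ) := by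
  refine ⟨(a ^ s + 1) * a ^ (-1 / 2 : ℝ), by positivity, fun t ht => ?_⟩
  have ht0 : 0 < t := lt_of_lt_of_le one_pos ht
  have hw : 0 < t * a := by positivity
  have has : 0 < a ^ s := by positivity
  have e : (a ^ s + 1) * a ^ (-1 / 2 : ℝ) * t ^ (-1 / 2 : ℝ) =
      (a ^ s + 1) * (t * a) ^ (-1 / 2 : ℝ) := by
    rw [Real.mul_rpow ht0.le ha.le]
    ring
  rw [e, envelope]
  split_ifs with h
  -- For `a ≤ 1` the product `t * a` may still be below `1`, but it stays in `[a, 1]`; `a ^ s + 1`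
  -- covers both signs of `s`.
  · have h1 : 1 ≤ (t * a) ^ (-1 / 2 : ℝ) :=
      Real.one_le_rpow_of_pos_of_le_one_of_nonpos hw h (by norm_num)
    have h2 : (t * a) ^ s ≤ a ^ s + 1 := by
      rcases le_total 0 s with hs | hs
      · linarith [Real.rpow_le_one hw.le h hs]
      · linarith [Real.rpow_le_rpow_of_nonpos ha (le_mul_of_one_le_left ha.le ht) hs]
    exact h2.trans (le_mul_of_one_le_right (by positivity) h1)
  · exact le_mul_of_one_le_left (by positivity) (by linarith)

lemma exists_norm_secondBessel_le {μ : ℝ} (hμ : 0 < μ) :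
    ∃ C, 0 ≤ C ∧ ∀ t w : ℝ, 1 ≤ t → 0 < w →
      ‖secondBessel μ ((t : ℂ) ^ 2) w‖ ≤ C * t ^ (1 / 8 : ℝ) * envelope (-μ) w := by
  by_cases h : ∃ n : ℕ, μ = n
  · obtain ⟨n, rfl⟩ := id h
    have hn : 0 < n := by exact_mod_cast hμ
    obtain ⟨A, hA0, hA⟩ := exists_norm_besselJ_le n
    obtain ⟨B, hB0, hB⟩ := exists_norm_besselYNat_le hn
    refine ⟨1 / Real.pi * 16 * A + B, by positivity, fun t w ht hw => ?_⟩
    have ht0 : 0 < t := lt_of_lt_of_le one_pos ht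
    -- `16 = 2 * 8`: the square inside the logarithm, and `log t ≤ 8 * t ^ (1/8)`.
    have hl : ‖Complex.log ((t : ℂ) ^ 2)‖ ≤ 16 * t ^ (1 / 8 : ℝ) := by
      rw [← Complex.ofReal_pow, ← Complex.ofReal_log (by positivity), Complex.norm_real,
        Real.log_pow, Real.norm_of_nonneg (mul_nonneg (by positivity) (Real.log_nonneg ht))]
      have := Real.log_le_rpow_div ht0.le (show (0 : ℝ) < 1 / 8 by norm_num)
      push_cast
      linarith
    have h1 : 1 ≤ t ^ (1 / 8 : ℝ) := Real.one_le_rpow ht (by norm_num)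
    have he := envelope_nonneg (-n) hw
    have hJ : ‖besselJ (n : ℝ) w‖ ≤ A * envelope (-n) w := (hA w hw).trans
      (mul_le_mul_of_nonneg_left (envelope_le_envelope_neg (by positivity) hw) hA0)
    rw [secondBessel, if_pos h, Nat.floor_natCast]
    calc _ ≤ 1 / Real.pi * (16 * t ^ (1 / 8 : ℝ)) * (A * envelope (-n) w) +
          1 * (B * envelope (-n) w) := by
          refine (norm_sub_le _ _).trans (add_le_add ?_ ?_)
          · rw [norm_mul, norm_mul, norm_div, norm_one, Complex.norm_real,
              Real.norm_of_nonneg Real.pi_pos.le]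
            gcongr
          · rw [one_mul]
            exact hB w hw
      _ ≤ 1 / Real.pi * (16 * t ^ (1 / 8 : ℝ)) * (A * envelope (-n) w) +
          t ^ (1 / 8 : ℝ) * (B * envelope (-n) w) := by gcongr
      _ = _ := by ring
  · obtain ⟨A, hA0, hA⟩ := exists_norm_besselJ_le (-μ)
    refine ⟨‖(1 / (Real.sin (μ * Real.pi) : ℂ))‖ * A, by positivity, fun t w ht hw => ?_⟩
    have h1 : 1 ≤ t ^ (1 / 8 : ℝ) := Real.one_le_rpow ht (by norm_num)
    have he := envelope_nonneg (-μ) hw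
    have hJ := hA w hw
    rw [Complex.ofReal_neg] at hJ
    rw [secondBessel, if_neg h, norm_mul]
    calc _ ≤ ‖(1 / (Real.sin (μ * Real.pi) : ℂ))‖ * (A * envelope (-μ) w) * 1 := by
          rw [mul_one]
          gcongr
      _ ≤ ‖(1 / (Real.sin (μ * Real.pi) : ℂ))‖ * (A * envelope (-μ) w) * t ^ (1 / 8 : ℝ) := by
          gcongr
      _ = _ := by ring

lemma continuousOn_secondBessel (μ : ℝ) (z : ℂ) :
    ContinuousOn (fun w : ℝ => secondBessel μ z w) (Set.Ioi 0) := by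
  by_cases h : ∃ n : ℕ, μ = n
  · simp only [secondBessel, if_pos h]
    exact (continuousOn_const.mul (continuousOn_besselJ μ)).sub (continuousOn_besselYNat _)
  · simp only [secondBessel, if_neg h]
    have := continuousOn_besselJ (-μ)
    rw [Complex.ofReal_neg] at this
    exact continuousOn_const.mul this

/-! ### Specialisation to `z = t ^ 2` -/

lemma csqrt_sq {t : ℝ} (ht : 0 < t) : csqrt ((t : ℂ) ^ 2) = t := by
  have h : ((1 / 2 : ℝ) : ℂ) = 1 / 2 := by norm_num
  rw [csqrt, ← h, ← Complex.ofReal_pow, ← Complex.ofReal_cpow (by positivity),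
    ← Real.sqrt_eq_rpow, Real.sqrt_sq ht.le]

lemma sq_cpow_half {t : ℝ} (ht : 0 < t) (s : ℝ) :
    ((t : ℂ) ^ 2) ^ ((s : ℂ) / 2) = ((t ^ s : ℝ) : ℂ) := by
  have h : ((s / 2 : ℝ) : ℂ) = s / 2 := by norm_num
  rw [← h, ← Complex.ofReal_pow, ← Complex.ofReal_cpow (by positivity), ← Real.rpow_natCast,
    ← Real.rpow_mul ht.le]
  congr 2
  push_cast
  ring

lemma xi_sq (μ : ℝ) {t : ℝ} (ht : 0 < t) (x : ℝ) :
    xi μ ((t : ℂ) ^ 2) x =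
      ((t ^ (-μ) * Real.sqrt (Real.pi * x / 2) : ℝ) : ℂ) * besselJ μ ((t * x : ℝ) : ℂ) := by
  rw [xi, csqrt_sq ht, ← Complex.ofReal_neg, sq_cpow_half ht]
  push_cast
  rfl

lemma theta_sq (μ : ℝ) {t : ℝ} (ht : 0 < t) (x : ℝ) :
    theta μ ((t : ℂ) ^ 2) x = ((t ^ μ * Real.sqrt (Real.pi * x / 2) : ℝ) : ℂ) *
      secondBessel μ ((t : ℂ) ^ 2) ((t * x : ℝ) : ℂ) := by
  rw [theta, csqrt_sq ht, sq_cpow_half ht, secondBessel]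
  push_cast
  rfl

lemma continuousOn_comp_mul {h : ℝ → ℂ} (hh : ContinuousOn h (Set.Ioi 0)) {t : ℝ} (ht : 0 < t)
    (c : ℝ) : ContinuousOn (fun x => ((c * Real.sqrt (Real.pi * x / 2) : ℝ) : ℂ) * h (t * x))
      (Set.Ioi 0) := by
  refine ContinuousOn.mul (Continuous.continuousOn (by fun_prop)) (hh.comp (by fun_prop) ?_)
  exact fun x (hx : 0 < x) => mul_pos ht hx

lemma continuousOn_xi_sq (μ : ℝ) {t : ℝ} (ht : 0 < t) :
    ContinuousOn (xi μ ((t : ℂ) ^ 2)) (Set.Ioi 0) :=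
  (continuousOn_comp_mul (continuousOn_besselJ μ) ht _).congr fun x _ => xi_sq μ ht x

lemma continuousOn_theta_sq (μ : ℝ) {t : ℝ} (ht : 0 < t) :
    ContinuousOn (theta μ ((t : ℂ) ^ 2)) (Set.Ioi 0) :=
  (continuousOn_comp_mul (continuousOn_secondBessel μ _) ht _).congr fun x _ => theta_sq μ ht x

/-! ### Integrals against `q` -/

/-- The dominating function `|x q(x)| x ^ (-1/4)` is integrable when `x q ∈ L^r` with `r > 2`. -/
lemma integrableOn_majorant {a : ℝ} (ha : 0 < a) {r : ℝ≥0∞} (hr : 2 < r) {q : ℝ → ℝ}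
    (hq : MemLp (fun x : ℝ => x * q x) r (volume.restrict (Set.Ioo 0 a))) :
    IntegrableOn (fun x : ℝ => |x * q x| * x ^ (-1 / 4 : ℝ)) (Set.Ioo 0 a) := by
  have h2 : MemLp (fun x : ℝ => |x * q x|) 2 (volume.restrict (Set.Ioo 0 a)) :=
    (hq.mono_exponent hr.le).norm
  have hp : MemLp (fun x : ℝ => x ^ (-1 / 4 : ℝ)) 2 (volume.restrict (Set.Ioo 0 a)) := by
    rw [memLp_two_iff_integrable_sq
      (by exact (measurable_id.pow_const (-1 / 4 : ℝ)).aestronglyMeasurable)]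
    have := (intervalIntegrable_iff_integrableOn_Ioo_of_le ha.le).1
      (intervalIntegral.intervalIntegrable_rpow' (a := 0) (b := a)
        (show (-1 : ℝ) < -1 / 2 by norm_num))
    refine this.congr_fun (fun x hx => ?_) measurableSet_Ioo
    rw [← Real.rpow_natCast, ← Real.rpow_mul hx.1.le]
    norm_num
  exact h2.integrable_mul hp

lemma integral_bound_of_majorant {a : ℝ} (ha : 0 < a) {r : ℝ≥0∞} (hr : 2 < r) {q : ℝ → ℝ}
    (hq : MemLp (fun x : ℝ => x * q x) r (volume.restrict (Set.Ioo 0 a)))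
    {F : ℝ → ℂ} (hF : ContinuousOn F (Set.Ioi 0)) {K : ℝ}
    (hK : ∀ x, 0 < x → ‖F x‖ ≤ K * (x * x ^ (-1 / 4 : ℝ))) :
    IntervalIntegrable (fun x => (q x : ℂ) * F x) volume 0 a ∧
      ‖∫ x in (0 : ℝ)..a, (q x : ℂ) * F x‖ ≤
        K * ∫ x in Set.Ioo 0 a, |x * q x| * x ^ (-1 / 4 : ℝ) := by
  have hm := (integrableOn_majorant ha hr hq).const_mul K
  have hle : ∀ᵐ x ∂(volume.restrict (Set.Ioo 0 a)),
      ‖(q x : ℂ) * F x‖ ≤ K * (|x * q x| * x ^ (-1 / 4 : ℝ)) := by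
    refine (ae_restrict_iff' measurableSet_Ioo).2 (Filter.Eventually.of_forall fun x hx => ?_)
    rw [norm_mul, Complex.norm_real, Real.norm_eq_abs, abs_mul, abs_of_pos hx.1]
    calc |q x| * ‖F x‖ ≤ |q x| * (K * (x * x ^ (-1 / 4 : ℝ))) := by
          gcongr
          exact hK x hx.1
      _ = _ := by ring
  have hmeas : AEStronglyMeasurable (fun x => (q x : ℂ) * F x)
      (volume.restrict (Set.Ioo 0 a)) := by
    -- Measurability is given for `x * q x` only, so the integrand is written as `(x q) * (x⁻¹ F)`.
    have h1 : AEStronglyMeasurable (fun x : ℝ => (x : ℂ)⁻¹ * F x) (volume.restrict (Set.Ioo 0 a)) :=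
      ((ContinuousOn.inv₀ (by fun_prop) fun x (hx : x ∈ Set.Ioo 0 a) => by
        exact_mod_cast hx.1.ne').mul (hF.mono fun x hx => hx.1)).aestronglyMeasurable
        measurableSet_Ioo
    have h2 : AEStronglyMeasurable (fun x => ((x * q x : ℝ) : ℂ))
        (volume.restrict (Set.Ioo 0 a)) :=
      Complex.continuous_ofReal.comp_aestronglyMeasurable hq.aestronglyMeasurable
    refine (h2.mul h1).congr ?_
    refine (ae_restrict_iff' measurableSet_Ioo).2 (Filter.Eventually.of_forall fun x hx => ?_)
    have : (x : ℂ) ≠ 0 := by exact_mod_cast hx.1.ne'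
    simp only [Pi.mul_apply]
    push_cast
    field_simp
  refine ⟨(intervalIntegrable_iff_integrableOn_Ioo_of_le ha.le).2 (hm.mono' hmeas hle), ?_⟩
  rw [intervalIntegral.integral_of_le ha.le, integral_Ioc_eq_integral_Ioo, ← integral_const_mul]
  exact norm_integral_le_of_norm_le hm hle

/-! ### Bounds for the integrands and for the values at `a` -/

lemma exists_norm_xi_sq_mul_le {μ : ℝ} (hμ : 0 ≤ μ) :
    ∃ K, 0 ≤ K ∧ ∀ t x : ℝ, 1 ≤ t → 0 < x →
      ‖xi μ ((t : ℂ) ^ 2) x ^ 2‖ ≤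
        K * t ^ (-2 * μ - 1 / 4) * (x * x ^ (-1 / 4 : ℝ)) := by
  obtain ⟨A, hA0, hA⟩ := exists_norm_besselJ_le μ
  refine ⟨Real.pi / 2 * A ^ 2, by positivity, fun t x ht hx => ?_⟩
  have ht0 : 0 < t := lt_of_lt_of_le one_pos ht
  have hw : 0 < t * x := by positivity
  have hJ : ‖besselJ μ ((t * x : ℝ) : ℂ)‖ ^ 2 ≤
      A ^ 2 * (t ^ (-1 / 4 : ℝ) * x ^ (-1 / 4 : ℝ)) := by
    have he := envelope_nonneg μ hw
    calc _ ≤ (A * envelope μ (t * x)) ^ 2 := by gcongr; exact hA _ hw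
      _ = A ^ 2 * (envelope μ (t * x) * envelope μ (t * x)) := by ring
      _ ≤ A ^ 2 * (envelope μ (t * x) * envelope (-μ) (t * x)) := by
          gcongr
          exact envelope_le_envelope_neg hμ hw
      _ ≤ A ^ 2 * (t * x) ^ (-1 / 4 : ℝ) := by
          gcongr
          exact envelope_mul_envelope_neg_le μ hw
      _ = _ := by rw [Real.mul_rpow ht0.le hx.le]
  have hp : t ^ (-2 * μ - 1 / 4) = (t ^ (-μ)) ^ 2 * t ^ (-1 / 4 : ℝ) := by
    rw [← Real.rpow_mul_natCast ht0.le, ← Real.rpow_add ht0]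
    congr 1
    push_cast
    ring
  rw [xi_sq μ ht0, norm_pow, norm_mul, Complex.norm_real, Real.norm_of_nonneg (by positivity),
    mul_pow, mul_pow, Real.sq_sqrt (by positivity), hp]
  calc _ ≤ (t ^ (-μ)) ^ 2 * (Real.pi * x / 2) *
        (A ^ 2 * (t ^ (-1 / 4 : ℝ) * x ^ (-1 / 4 : ℝ))) := by gcongr
    _ = _ := by ring

/-- The prefactors `t ^ μ` and `t ^ (-μ)` cancel; the net gain `1/8 - 1/4 = -1/8` is the source of
`δ`. -/
lemma exists_norm_theta_mul_xi_le {μ : ℝ} (hμ : 0 < μ) :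
    ∃ K, 0 ≤ K ∧ ∀ t x : ℝ, 1 ≤ t → 0 < x →
      ‖theta μ ((t : ℂ) ^ 2) x * xi μ ((t : ℂ) ^ 2) x‖ ≤
        K * t ^ (-1 / 8 : ℝ) * (x * x ^ (-1 / 4 : ℝ)) := by
  obtain ⟨A, hA0, hA⟩ := exists_norm_besselJ_le μ
  obtain ⟨B, hB0, hB⟩ := exists_norm_secondBessel_le hμ
  refine ⟨Real.pi / 2 * (A * B), by positivity, fun t x ht hx => ?_⟩
  have ht0 : 0 < t := lt_of_lt_of_le one_pos ht
  have hw : 0 < t * x := by positivity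
  have hp : t ^ (-1 / 8 : ℝ) = t ^ (1 / 8 : ℝ) * t ^ (-1 / 4 : ℝ) := by
    rw [← Real.rpow_add ht0]
    norm_num
  have hm : t ^ μ * t ^ (-μ) = 1 := by
    rw [← Real.rpow_add ht0, add_neg_cancel, Real.rpow_zero]
  have hJ : ‖secondBessel μ ((t : ℂ) ^ 2) ((t * x : ℝ) : ℂ)‖ * ‖besselJ μ ((t * x : ℝ) : ℂ)‖ ≤
      A * B * t ^ (1 / 8 : ℝ) * (t ^ (-1 / 4 : ℝ) * x ^ (-1 / 4 : ℝ)) := by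
    have he := envelope_nonneg (-μ) hw
    calc _ ≤ (B * t ^ (1 / 8 : ℝ) * envelope (-μ) (t * x)) * (A * envelope μ (t * x)) :=
          mul_le_mul (hB t _ ht hw) (hA _ hw) (norm_nonneg _) (by positivity)
      _ = A * B * t ^ (1 / 8 : ℝ) * (envelope μ (t * x) * envelope (-μ) (t * x)) := by ring
      _ ≤ A * B * t ^ (1 / 8 : ℝ) * (t * x) ^ (-1 / 4 : ℝ) := by
          gcongr
          exact envelope_mul_envelope_neg_le μ hw
      _ = _ := by rw [Real.mul_rpow ht0.le hx.le]
  rw [theta_sq μ ht0, xi_sq μ ht0, norm_mul, norm_mul, norm_mul, Complex.norm_real,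
    Complex.norm_real, Real.norm_of_nonneg (by positivity), Real.norm_of_nonneg (by positivity), hp]
  calc _ = (t ^ μ * t ^ (-μ)) * (Real.sqrt (Real.pi * x / 2) * Real.sqrt (Real.pi * x / 2)) *
        (‖secondBessel μ ((t : ℂ) ^ 2) ((t * x : ℝ) : ℂ)‖ *
          ‖besselJ μ ((t * x : ℝ) : ℂ)‖) := by ring
    _ ≤ 1 * (Real.pi * x / 2) *
        (A * B * t ^ (1 / 8 : ℝ) * (t ^ (-1 / 4 : ℝ) * x ^ (-1 / 4 : ℝ))) := by
      rw [hm, Real.mul_self_sqrt (by positivity)]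
      gcongr
    _ = _ := by ring

/-- For `μ = ν + 1` this is already the rate `t ^ (-ν - 3/2)`, so any power decay of `Q₁` suffices.
-/
lemma exists_norm_xi_sq_le (μ : ℝ) {a : ℝ} (ha : 0 < a) :
    ∃ K, 0 ≤ K ∧ ∀ t : ℝ, 1 ≤ t → ‖xi μ ((t : ℂ) ^ 2) a‖ ≤ K * t ^ (-μ - 1 / 2) := by
  obtain ⟨A, hA0, hA⟩ := exists_norm_besselJ_le μ
  obtain ⟨D, hD0, hD⟩ := exists_envelope_le μ ha
  refine ⟨Real.sqrt (Real.pi * a / 2) * (A * D), by positivity, fun t ht => ?_⟩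
  have ht0 : 0 < t := lt_of_lt_of_le one_pos ht
  rw [xi_sq μ ht0, norm_mul, Complex.norm_real, Real.norm_of_nonneg (by positivity)]
  calc _ ≤ t ^ (-μ) * Real.sqrt (Real.pi * a / 2) * (A * (D * t ^ (-1 / 2 : ℝ))) := by
        gcongr
        exact (hA _ (by positivity)).trans (mul_le_mul_of_nonneg_left (hD t ht) hA0)
    _ = Real.sqrt (Real.pi * a / 2) * (A * D) * (t ^ (-μ) * t ^ (-1 / 2 : ℝ)) := by ring
    _ = _ := by
        rw [← Real.rpow_add ht0]
        ring_nf

lemma exists_norm_theta_sq_le {μ : ℝ} (hμ : 0 < μ) {a : ℝ} (ha : 0 < a) :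
    ∃ K, 0 ≤ K ∧ ∀ t : ℝ, 1 ≤ t → ‖theta μ ((t : ℂ) ^ 2) a‖ ≤ K * t ^ (μ - 3 / 8) := by
  obtain ⟨B, hB0, hB⟩ := exists_norm_secondBessel_le hμ
  obtain ⟨D, hD0, hD⟩ := exists_envelope_le (-μ) ha
  refine ⟨Real.sqrt (Real.pi * a / 2) * (B * D), by positivity, fun t ht => ?_⟩
  have ht0 : 0 < t := lt_of_lt_of_le one_pos ht
  rw [theta_sq μ ht0, norm_mul, Complex.norm_real, Real.norm_of_nonneg (by positivity)]
  calc _ ≤ t ^ μ * Real.sqrt (Real.pi * a / 2) *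
          (B * t ^ (1 / 8 : ℝ) * (D * t ^ (-1 / 2 : ℝ))) := by
        gcongr
        exact (hB t _ ht (by positivity)).trans
          (mul_le_mul_of_nonneg_left (hD t ht) (by positivity))
    _ = Real.sqrt (Real.pi * a / 2) * (B * D) *
          (t ^ μ * t ^ (1 / 8 : ℝ) * t ^ (-1 / 2 : ℝ)) := by ring
    _ = _ := by
        rw [← Real.rpow_add ht0, ← Real.rpow_add ht0]
        ring_nf

end PerturbedBessel

theorem mainTheorem6 (ν : ℝ) (hν : 0 < ν) (a : ℝ) (ha : 0 < a)
    (r : ℝ≥0∞) (hr : 2 < r) (q : ℝ → ℝ)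
    (hq : MemLp (fun x : ℝ => x * q x) r (volume.restrict (Set.Ioo 0 a))) :
    (∀ t : ℝ, 1 ≤ t →
      IntervalIntegrable
        (fun y : ℝ => (q y : ℂ) * PerturbedBessel.theta ν ((t : ℂ) ^ 2) y *
          PerturbedBessel.xi ν ((t : ℂ) ^ 2) y) volume 0 a ∧
      IntervalIntegrable
        (fun y : ℝ => (q y : ℂ) * PerturbedBessel.xi ν ((t : ℂ) ^ 2) y ^ 2) volume 0 a) ∧
    ∃ C : ℝ, 0 < C ∧ ∃ δ : ℝ, 0 < δ ∧ ∀ t : ℝ, 1 ≤ t →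
      ‖PerturbedBessel.Q₁ ν q ((t : ℂ) ^ 2) a * PerturbedBessel.xi (ν + 1) ((t : ℂ) ^ 2) a -
          ((t : ℂ) ^ 2)⁻¹ * PerturbedBessel.Q₂ ν q ((t : ℂ) ^ 2) a *
            PerturbedBessel.theta (ν + 1) ((t : ℂ) ^ 2) a‖
        ≤ C * t ^ (-ν - 3 / 2 - δ) := by
  obtain ⟨K₁, hK₁, h₁⟩ := PerturbedBessel.exists_norm_theta_mul_xi_le hν
  obtain ⟨K₂, hK₂, h₂⟩ := PerturbedBessel.exists_norm_xi_sq_mul_le hν.le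
  obtain ⟨X, hX, hxi⟩ := PerturbedBessel.exists_norm_xi_sq_le (ν + 1) ha
  obtain ⟨T, hT, htheta⟩ :=
    PerturbedBessel.exists_norm_theta_sq_le (show 0 < ν + 1 by linarith) ha
  set N : ℝ := ∫ x in Set.Ioo 0 a, |x * q x| * x ^ (-1 / 4 : ℝ) with hN
  have hN0 : 0 ≤ N := setIntegral_nonneg measurableSet_Ioo fun x hx =>
    mul_nonneg (abs_nonneg _) (Real.rpow_nonneg hx.1.le _)
  have hQ₁ : ∀ t : ℝ, 1 ≤ t →
      IntervalIntegrable
        (fun y : ℝ => (q y : ℂ) * PerturbedBessel.theta ν ((t : ℂ) ^ 2) y *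
          PerturbedBessel.xi ν ((t : ℂ) ^ 2) y) volume 0 a ∧
      ‖PerturbedBessel.Q₁ ν q ((t : ℂ) ^ 2) a‖ ≤ K₁ * t ^ (-1 / 8 : ℝ) * N := by
    intro t ht
    have ht0 : 0 < t := lt_of_lt_of_le one_pos ht
    simp only [PerturbedBessel.Q₁, mul_assoc (Complex.ofReal _)]
    exact PerturbedBessel.integral_bound_of_majorant ha hr hq
      ((PerturbedBessel.continuousOn_theta_sq ν ht0).mul
        (PerturbedBessel.continuousOn_xi_sq ν ht0)) (fun x hx => h₁ t x ht hx)
  have hQ₂ : ∀ t : ℝ, 1 ≤ t →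
      IntervalIntegrable
        (fun y : ℝ => (q y : ℂ) * PerturbedBessel.xi ν ((t : ℂ) ^ 2) y ^ 2) volume 0 a ∧
      ‖PerturbedBessel.Q₂ ν q ((t : ℂ) ^ 2) a‖ ≤ K₂ * t ^ (-2 * ν - 1 / 4) * N := by
    intro t ht
    have ht0 : 0 < t := lt_of_lt_of_le one_pos ht
    exact PerturbedBessel.integral_bound_of_majorant ha hr hq
      ((PerturbedBessel.continuousOn_xi_sq ν ht0).pow 2) (fun x hx => h₂ t x ht hx)
  -- The summand `1` only makes the constant positive. Both terms have the same exponent, as `-2 +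
  -- (-2ν - 1/4) + (ν + 1 - 3/8) = -ν - 3/2 - 1/8`.
  refine ⟨fun t ht => ⟨(hQ₁ t ht).1, (hQ₂ t ht).1⟩, K₁ * N * X + K₂ * N * T + 1, by positivity,
    1 / 8, by norm_num, fun t ht => ?_⟩
  have ht0 : 0 < t := lt_of_lt_of_le one_pos ht
  have b₁ := (hQ₁ t ht).2
  have b₂ := (hQ₂ t ht).2
  have e₁ : t ^ (-1 / 8 : ℝ) * t ^ (-(ν + 1) - 1 / 2) = t ^ (-ν - 3 / 2 - 1 / 8) := by
    rw [← Real.rpow_add ht0]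
    ring_nf
  have e₂ : (t ^ 2)⁻¹ * t ^ (-2 * ν - 1 / 4) * t ^ (ν + 1 - 3 / 8) =
      t ^ (-ν - 3 / 2 - 1 / 8) := by
    rw [← Real.rpow_natCast, ← Real.rpow_neg ht0.le, ← Real.rpow_add ht0, ← Real.rpow_add ht0]
    push_cast
    ring_nf
  have hn : ‖((t : ℂ) ^ 2)⁻¹‖ = (t ^ 2)⁻¹ := by
    rw [norm_inv, norm_pow, Complex.norm_real, Real.norm_of_nonneg ht0.le]
  calc _ ≤ K₁ * t ^ (-1 / 8 : ℝ) * N * (X * t ^ (-(ν + 1) - 1 / 2)) +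
        (t ^ 2)⁻¹ * (K₂ * t ^ (-2 * ν - 1 / 4) * N) * (T * t ^ (ν + 1 - 3 / 8)) := by
        refine (norm_sub_le _ _).trans ?_
        rw [norm_mul, norm_mul, norm_mul, hn]
        gcongr
        · exact hxi t ht
        · exact htheta t ht
    _ = K₁ * N * X * (t ^ (-1 / 8 : ℝ) * t ^ (-(ν + 1) - 1 / 2)) + K₂ * N * T *
        ((t ^ 2)⁻¹ * t ^ (-2 * ν - 1 / 4) * t ^ (ν + 1 - 3 / 8)) := by ring
    _ = (K₁ * N * X + K₂ * N * T) * t ^ (-ν - 3 / 2 - 1 / 8) := by rw [e₁, e₂]; ring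
    _ ≤ _ := mul_le_mul_of_nonneg_right (by linarith) (by positivity)
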